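/- Let $\sigma,t>0$. For $z_k=x_k+\mathrm{i}y_k\in\mathbb{C}$ put $$K_{\sin}^{\sigma}(z_1,z_2):=\frac{1}{\sigma\sqrt{\pi}}\exp\left[-\frac{y_1^2+y_2^2}{2\sigma^2}\right]\frac{1}{2\pi}\int_{-\pi}^{\pi}e^{-(\sigma u)^2}\cos\big(u(z_1-\overline{z_2})\big)\,du,$$ let $J_t:=(-t,t)\times\mathbb{R}\subset\mathbb{R}^2\simeq\mathbb{C}$, and let $G_\sigma(t)$ be the Fredholm determinant of $K_{\sin}^{\sigma}$ on $J_t$, $$G_{\sigma}(t):=1+\sum_{\ell=1}^{\infty}\frac{(-1)^{\ell}}{\ell!}\int_{(J_t)^{\ell}}\det\big[K_{\sin}^{\sigma}(z_j,z_k)\big]_{j,k=1}^{\ell}\,d^2z_1\cdots d^2z_{\ell}.$$ Let $S_t^{\sigma}:L^2(-t,t)\to L^2(-t,t)$ be the integral operator on the complex Hilbert space $L^2(-t,t)$ with kernel $$S_t^{\sigma}(a,b):=\frac{\sin\pi(a-b)}{\pi(a-b)}\exp\left[-\left(\frac{\pi\sigma}{2t}(a-b)\right)^2\right]$$ (the first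 factor being $1$ for $a=b$), and let $\omega_k(S_t^\sigma,(-t,t))$ be its non-zero eigenvalues, counted according to their algebraic multiplicities. Then the integrals defining $G_\sigma(t)$ and the series converge absolutely, each non-zero eigenvalue of $S_t^\sigma$ has finite multiplicity, $\sum_k|\omega_k(S_t^\sigma,(-t,t))|<\infty$, and $$G_{\sigma}(t)=\prod_{k}\Big(1-\omega_k\big(S_t^{\sigma},(-t,t)\big)\Big),$$ where the product runs over all these eigenvalues and converges unconditionally. -/

import Mathlib

open MeasureTheory

/-! ### Integral operators with square-integrable kernel -/

section IntegralOperator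

variable {α : Type*} [MeasurableSpace α] {μ : Measure α} [SFinite μ] {k : α → α → ℂ}

theorem memLp_two_ae_slice (hk : MemLp (Function.uncurry k) 2 (μ.prod μ)) :
    ∀ᵐ x ∂μ, MemLp (k x) 2 μ := by
  have hm := hk.1.prodMk_left
  have hfin : ∫⁻ x, ∫⁻ y, ‖k x y‖ₑ ^ (2 : ℝ) ∂μ ∂μ ≠ ⊤ := by
    have h := hk.2
    rw [eLpNorm_lt_top_iff_lintegral_rpow_enorm_lt_top (by simp) (by simp)] at h
    have h2 : AEMeasurable (fun p : α × α => ‖Function.uncurry k p‖ₑ ^ (2 : ℝ)) (μ.prod μ) :=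
      hk.1.enorm.pow_const _
    simp only [ENNReal.toReal_ofNat] at h
    rw [lintegral_prod _ h2] at h
    exact h.ne
  have h2 : AEMeasurable (fun p : α × α => ‖Function.uncurry k p‖ₑ ^ (2 : ℝ)) (μ.prod μ) :=
    hk.1.enorm.pow_const _
  filter_upwards [hm, ae_lt_top' h2.lintegral_prod_right' hfin] with x hx hx2
  refine ⟨hx, ?_⟩
  rw [eLpNorm_lt_top_iff_lintegral_rpow_enorm_lt_top (by simp) (by simp)]
  simpa using hx2

theorem eLpNorm_kernelIntegral_le (hk : MemLp (Function.uncurry k) 2 (μ.prod μ))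
    (f : Lp ℂ 2 μ) :
    eLpNorm (fun x => ∫ y, k x y * f y ∂μ) 2 μ
      ≤ eLpNorm (Function.uncurry k) 2 (μ.prod μ) * eLpNorm f 2 μ := by
  have h2 : AEMeasurable (fun p : α × α => ‖Function.uncurry k p‖ₑ ^ (2 : ℝ)) (μ.prod μ) :=
    hk.1.enorm.pow_const _
  have key : ∀ᵐ x ∂μ, ‖∫ y, k x y * f y ∂μ‖ₑ ^ (2 : ℝ)
      ≤ (∫⁻ y, ‖k x y‖ₑ ^ (2 : ℝ) ∂μ) * ∫⁻ y, ‖f y‖ₑ ^ (2 : ℝ) ∂μ := by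
    filter_upwards [hk.1.prodMk_left] with x hx
    have h := ENNReal.lintegral_mul_le_Lp_mul_Lq μ Real.HolderConjugate.two_two
      (AEStronglyMeasurable.enorm hx) (Lp.aestronglyMeasurable f).enorm
    have h1 : ‖∫ y, k x y * f y ∂μ‖ₑ ≤ ∫⁻ y, ‖k x y‖ₑ * ‖f y‖ₑ ∂μ := by
      refine (enorm_integral_le_lintegral_enorm _).trans (le_of_eq ?_)
      simp
    calc ‖∫ y, k x y * f y ∂μ‖ₑ ^ (2 : ℝ)
        ≤ ((∫⁻ y, ‖k x y‖ₑ ^ (2 : ℝ) ∂μ) ^ (1 / (2 : ℝ))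
            * (∫⁻ y, ‖f y‖ₑ ^ (2 : ℝ) ∂μ) ^ (1 / (2 : ℝ))) ^ (2 : ℝ) :=
          ENNReal.rpow_le_rpow (h1.trans h) (by norm_num)
      _ = _ := by
          rw [ENNReal.mul_rpow_of_nonneg _ _ (by norm_num), ← ENNReal.rpow_mul,
            ← ENNReal.rpow_mul]
          norm_num
  rw [eLpNorm_eq_lintegral_rpow_enorm_toReal (by simp) (by simp),
    eLpNorm_eq_lintegral_rpow_enorm_toReal (by simp) (by simp),
    eLpNorm_eq_lintegral_rpow_enorm_toReal (by simp) (by simp)]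
  simp only [ENNReal.toReal_ofNat]
  rw [← ENNReal.mul_rpow_of_nonneg _ _ (by norm_num)]
  refine ENNReal.rpow_le_rpow ?_ (by norm_num)
  rw [lintegral_prod _ h2, ← lintegral_mul_const'' _ h2.lintegral_prod_right']
  exact lintegral_mono_ae key

theorem memLp_kernelIntegral (hk : MemLp (Function.uncurry k) 2 (μ.prod μ)) (f : Lp ℂ 2 μ) :
    MemLp (fun x => ∫ y, k x y * f y ∂μ) 2 μ := by
  refine ⟨?_, (eLpNorm_kernelIntegral_le hk f).trans_lt
    (ENNReal.mul_lt_top hk.2 (Lp.memLp f).2)⟩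
  have h : AEStronglyMeasurable (fun p : α × α => Function.uncurry k p * f p.2) (μ.prod μ) :=
    hk.1.mul (Lp.aestronglyMeasurable f).comp_snd
  exact h.integral_prod_right'

theorem ae_integrable_kernel_mul (hk : MemLp (Function.uncurry k) 2 (μ.prod μ))
    (f : Lp ℂ 2 μ) : ∀ᵐ x ∂μ, Integrable (fun y => k x y * f y) μ := by
  filter_upwards [memLp_two_ae_slice hk] with x hx
  exact hx.integrable_mul (Lp.memLp f)

/-- The bounded operator on the complex Hilbert space `L²(μ)` with square-integrable kernel `k`,
`(T f)(x) = ∫ k(x, y) f(y) dμ(y)`. -/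
noncomputable def integralOperator (μ : Measure α) [SFinite μ] (k : α → α → ℂ)
    (hk : MemLp (Function.uncurry k) 2 (μ.prod μ)) : Lp ℂ 2 μ →L[ℂ] Lp ℂ 2 μ :=
  LinearMap.mkContinuous
    { toFun := fun f => (memLp_kernelIntegral hk f).toLp (fun x => ∫ y, k x y * f y ∂μ)
      map_add' := by
        intro f g
        rw [← MemLp.toLp_add, MemLp.toLp_eq_toLp_iff]
        filter_upwards [ae_integrable_kernel_mul hk f, ae_integrable_kernel_mul hk g] with x hf hg
        rw [Pi.add_apply, ← integral_add hf hg]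
        refine integral_congr_ae ?_
        filter_upwards [Lp.coeFn_add f g] with y hy
        rw [hy, Pi.add_apply, mul_add]
      map_smul' := by
        intro c f
        rw [RingHom.id_apply, ← MemLp.toLp_const_smul, MemLp.toLp_eq_toLp_iff]
        refine Filter.Eventually.of_forall fun x => ?_
        simp only [Pi.smul_apply, smul_eq_mul]
        rw [← integral_const_mul]
        refine integral_congr_ae ?_
        filter_upwards [Lp.coeFn_smul c f] with y hy
        rw [hy, Pi.smul_apply, smul_eq_mul]
        ring }
    (eLpNorm (Function.uncurry k) 2 (μ.prod μ)).toReal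
    (by
      intro f
      change ‖(memLp_kernelIntegral hk f).toLp _‖ ≤ _
      rw [Lp.norm_toLp, Lp.norm_def, ← ENNReal.toReal_mul]
      exact ENNReal.toReal_mono (ENNReal.mul_ne_top hk.2.ne (Lp.memLp f).2.ne)
        (eLpNorm_kernelIntegral_le hk f))

end IntegralOperator

/-! ### Non-zero eigenvalues counted with multiplicity -/

section Eigenvalues

variable {E : Type*} [NormedAddCommGroup E] [NormedSpace ℂ E]

/-- The algebraic multiplicity of `z` for `T`: the dimension of the space of all vectors that are
annihilated by some power of `T - z`. -/
noncomputable def algMultiplicity (T : E →L[ℂ] E) (z : ℂ) : ℕ :=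
  Module.finrank ℂ (Module.End.maxGenEigenspace (T : Module.End ℂ E) z)

/-- Index set of the non-zero eigenvalues of `T`, in which each eigenvalue occurs as often as its
algebraic multiplicity says. -/
def NonzeroEigenvalueIndex (T : E →L[ℂ] E) : Type :=
  Σ z : {z : ℂ // z ≠ 0 ∧ Module.End.HasEigenvalue (T : Module.End ℂ E) z},
    Fin (algMultiplicity T z)

/-- The family of non-zero eigenvalues of `T`, counted according to multiplicity. -/
def nonzeroEigenvalue (T : E →L[ℂ] E) (i : NonzeroEigenvalueIndex T) : ℂ := i.1

end Eigenvalues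

/-! ### The kernels -/

/-- The vertical strip `J_t = (-t, t) × ℝ` in the complex plane. -/
def strip (t : ℝ) : Set ℂ := {z : ℂ | z.re ∈ Set.Ioo (-t) t}

/-- The kernel `K_sin^σ` on the complex plane. -/
noncomputable def sinKernel (σ : ℝ) (z w : ℂ) : ℂ :=
  ((1 / (σ * √Real.pi) * Real.exp (-(z.im ^ 2 + w.im ^ 2) / (2 * σ ^ 2)) : ℝ) : ℂ)
    * (1 / (2 * (Real.pi : ℂ))
      * ∫ u in (-Real.pi)..Real.pi,
          (Real.exp (-(σ * u) ^ 2) : ℂ) * Complex.cos (u * (z - (starRingEnd ℂ) w)))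

/-- `det [K_sin^σ(z_j, z_k)]` for `ℓ` points `z_1, …, z_ℓ` of the complex plane. -/
noncomputable def sinKernelDet (σ : ℝ) (ℓ : ℕ) (z : Fin ℓ → ℂ) : ℂ :=
  Matrix.det (Matrix.of fun j k => sinKernel σ (z j) (z k))

/-- The term `(-1)^ℓ / ℓ! ∫_{J_t^ℓ} det [K_sin^σ(z_j, z_k)] d²z_1 ⋯ d²z_ℓ` of the Fredholm series,
where `d²z` is Lebesgue measure on the complex plane. -/
noncomputable def fredholmTerm (σ t : ℝ) (ℓ : ℕ) : ℂ :=
  ((-1) ^ ℓ / (ℓ.factorial : ℂ))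
    * ∫ z in Set.univ.pi (fun _ : Fin ℓ => strip t), sinKernelDet σ ℓ z

/-- The Fredholm determinant `G_σ(t)` of `K_sin^σ` on the strip `J_t`, as a Fredholm series. -/
noncomputable def fredholmG (σ t : ℝ) : ℂ := 1 + ∑' ℓ : ℕ, fredholmTerm σ t (ℓ + 1)

/-- The Gaussian-damped sine kernel `S_t^σ(a, b)`. Here `Real.sinc x` is `sin x / x`, with the
value `1` at `x = 0`. -/
noncomputable def dampedSineKernel (σ t a b : ℝ) : ℂ :=
  ((Real.sinc (Real.pi * (a - b)) * Real.exp (-(Real.pi * σ / (2 * t) * (a - b)) ^ 2) : ℝ) : ℂ)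

theorem memLp_dampedSineKernel (σ t : ℝ) :
    MemLp (Function.uncurry (dampedSineKernel σ t)) 2
      ((volume.restrict (Set.Ioo (-t) t)).prod (volume.restrict (Set.Ioo (-t) t))) := by
  refine MemLp.of_bound (C := 1) ?_ (Filter.Eventually.of_forall fun p => ?_)
  · refine Continuous.aestronglyMeasurable ?_
    unfold dampedSineKernel Function.uncurry
    have := Real.continuous_sinc
    fun_prop
  · simp only [Function.uncurry, dampedSineKernel, Complex.norm_real, norm_mul, Real.norm_eq_abs,
      Real.abs_exp]
    refine mul_le_one₀ (Real.abs_sinc_le_one _) (Real.exp_pos _).le ?_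
    rw [Real.exp_le_one_iff]
    exact neg_nonpos.mpr (sq_nonneg _)

/-- The integral operator `S_t^σ` on `L²(-t, t)`. -/
noncomputable def dampedSineOperator (σ t : ℝ) :
    Lp ℂ 2 (volume.restrict (Set.Ioo (-t) t)) →L[ℂ] Lp ℂ 2 (volume.restrict (Set.Ioo (-t) t)) :=
  integralOperator (volume.restrict (Set.Ioo (-t) t)) (dampedSineKernel σ t)
    (memLp_dampedSineKernel σ t)

/-! The kernel on the strip and the operator on the interval are two Gram objects of one family of
vectors. With the coherent states $v_z\in L^2(-t,t)$, $v_z(a)$ = `coherentState σ t z a`, two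
explicit integrals give $$\langle v_z,v_w\rangle=K_{\sin}^\sigma(z,w),\qquad
\int_{J_t}|v_z\rangle\langle v_z|\,d^2z=S_t^\sigma .$$ So, formally, $K=VV^*$ and $S=V^*V$ for one
operator $V$, and $\det(1-VV^*)=\det(1-V^*V)$. The two identities are `inner_coherentVector` and
`isRankOneIntegral_dampedSineOperator`.

The abstract half concerns any $T=\int|v_z\rangle\langle v_z|\,d\mu(z)$ with
$\int\|v_z\|^2d\mu<\infty$ on a separable Hilbert space. Such a $T$ is symmetric, and compact as a
norm limit of finite-rank operators, so it has a Hilbert basis $b$ of eigenvectors, with eigenvalues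
$a_i$. Insert $\sum_{i\in s}|b_i\rangle\langle b_i|$, with $s$ finite, into $\langle
v_z,v_w\rangle$. The $\ell$-th determinant integral of this truncated kernel becomes $\ell!$ times
the $\ell$-th elementary symmetric polynomial of $(a_i)_{i\in s}$, so its Fredholm series is
$\prod_{i\in s}(1-a_i)$. Dominated convergence, in $z$ for fixed $\ell$ and then in the sum over
$\ell$, lets $s$ grow (`hasProd_one_sub`). The majorant in $\ell$ is $(\int\|v\|^2)^\ell/\ell!$.
Vectors of $b$ in the kernel of $T$ contribute factors $1$. -/

section RankOneIntegral

open Filter Topology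
open scoped InnerProductSpace

variable {Z H ι : Type*} [NormedAddCommGroup H] [InnerProductSpace ℂ H]

/-! ### Bessel remainders and kernels truncated along an orthonormal family. -/

theorem Orthonormal.norm_sub_sum_inner_sq {e : ι → H} (he : Orthonormal ℂ e) (s : Finset ι)
    (u : H) : ‖u - ∑ i ∈ s, ⟪e i, u⟫_ℂ • e i‖ ^ 2 = ‖u‖ ^ 2 - ∑ i ∈ s, ‖⟪u, e i⟫_ℂ‖ ^ 2 := by
  set q := ∑ i ∈ s, ⟪e i, u⟫_ℂ • e i with hq
  have h1 : ⟪q, u⟫_ℂ = ((∑ i ∈ s, ‖⟪u, e i⟫_ℂ‖ ^ 2 : ℝ) : ℂ) := by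
    rw [hq, sum_inner]
    push_cast
    refine Finset.sum_congr rfl fun i _ => ?_
    rw [inner_smul_left, Complex.conj_mul', norm_inner_symm]
  have h2 : ⟪q, q⟫_ℂ = ((∑ i ∈ s, ‖⟪u, e i⟫_ℂ‖ ^ 2 : ℝ) : ℂ) := by
    rw [hq, he.inner_sum]
    push_cast
    refine Finset.sum_congr rfl fun i _ => ?_
    rw [Complex.conj_mul', norm_inner_symm]
  have h3 : ‖q‖ ^ 2 = ∑ i ∈ s, ‖⟪u, e i⟫_ℂ‖ ^ 2 := by
    rw [← Complex.ofReal_inj, ← h2, inner_self_eq_norm_sq_to_K]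
    simp
  rw [norm_sub_sq (𝕜 := ℂ), h3, ← inner_conj_symm, h1, Complex.conj_ofReal, RCLike.re_to_complex,
    Complex.ofReal_re]
  ring

/-- The complementary projection is self-adjoint, so it can be moved from `x` to `u`; Cauchy–Schwarz
then leaves the Bessel remainder of `u`. -/
theorem Orthonormal.norm_inner_sub_sum_le {e : ι → H} (he : Orthonormal ℂ e) (s : Finset ι)
    (u x : H) : ‖⟪u, x - ∑ i ∈ s, ⟪e i, x⟫_ℂ • e i⟫_ℂ‖
      ≤ √(‖u‖ ^ 2 - ∑ i ∈ s, ‖⟪u, e i⟫_ℂ‖ ^ 2) * ‖x‖ := by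
  have : ⟪u, x - ∑ i ∈ s, ⟪e i, x⟫_ℂ • e i⟫_ℂ = ⟪u - ∑ i ∈ s, ⟪e i, u⟫_ℂ • e i, x⟫_ℂ := by
    simp only [inner_sub_left, inner_sub_right, inner_sum, sum_inner, inner_smul_left,
      inner_smul_right, inner_conj_symm]
    simp only [mul_comm]
  rw [this, ← he.norm_sub_sum_inner_sq, Real.sqrt_sq (norm_nonneg _)]
  exact norm_inner_le_norm _ _

/-- Distinct vectors lie at distance $\sqrt2$, so the range is discrete. Countability of `ι` makes
`atTop` on `Finset ι` countably generated, which dominated convergence along finite sets requires.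
-/
theorem Orthonormal.countable [TopologicalSpace.SeparableSpace H] {e : ι → H}
    (he : Orthonormal ℂ e) : Countable ι := by
  have : SecondCountableTopology H := UniformSpace.secondCountable_of_separable H
  have hd : DiscreteTopology (Set.range e) := by
    refine DiscreteTopology.of_forall_le_dist (r := 1) one_pos ?_
    rintro ⟨_, i, rfl⟩ ⟨_, j, rfl⟩ hij
    have hij' : i ≠ j := fun h => hij (by simp [h])
    rw [Subtype.dist_eq, dist_eq_norm]
    have h := norm_sub_sq (𝕜 := ℂ) (e i) (e j)
    rw [he.inner_eq_zero hij', he.norm_eq_one, he.norm_eq_one] at h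
    norm_num at h
    nlinarith [norm_nonneg (e i - e j)]
  have : Countable (Set.range e) := countable_of_Lindelof_of_discrete
  exact (Set.rangeFactorization_injective.mpr he.linearIndependent.injective).countable

/-- The truncated kernel `∑_{i ∈ s} ⟪v z, e i⟫ ⟪e i, v w⟫`. -/
noncomputable def truncatedKernel (v : Z → H) (e : ι → H) (s : Finset ι) (z w : Z) : ℂ :=
  ∑ i ∈ s, ⟪v z, e i⟫_ℂ * ⟪e i, v w⟫_ℂ

/-- Cauchy–Schwarz over `s` and Bessel in each variable. The bound does not depend on `s`, so it
serves as a majorant. -/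
theorem norm_truncatedKernel_le {e : ι → H} (he : Orthonormal ℂ e) (s : Finset ι) (z w : Z) :
    ‖truncatedKernel v e s z w‖ ≤ ‖v z‖ * ‖v w‖ := by
  refine (norm_sum_le _ _).trans ?_
  simp_rw [norm_mul]
  refine (Real.sum_mul_le_sqrt_mul_sqrt _ _ _).trans ?_
  gcongr
  · refine Real.sqrt_le_iff.mpr ⟨norm_nonneg _, ?_⟩
    simp_rw [norm_inner_symm (v z)]
    exact he.sum_inner_products_le _
  · refine Real.sqrt_le_iff.mpr ⟨norm_nonneg _, ?_⟩
    exact he.sum_inner_products_le _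

theorem tendsto_truncatedKernel [CompleteSpace H] (b : HilbertBasis ι ℂ H) (z w : Z) :
    Tendsto (fun s => truncatedKernel v b s z w) atTop (𝓝 ⟪v z, v w⟫_ℂ) :=
  b.hasSum_inner_mul_inner _ _

/-! ### Operators $\int|v_z\rangle\langle v_z|\,d\mu$: symmetry, trace bound, compactness. -/

variable [MeasurableSpace Z] {μ : Measure Z} {v : Z → H} {T : H →L[ℂ] H}

/-- `T = ∫ |v z⟩⟨v z| dμ(z)` in the weak sense, for a weakly measurable square-integrable family
`v`. -/
structure IsRankOneIntegral (μ : Measure Z) (v : Z → H) (T : H →L[ℂ] H) : Prop where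
  aestronglyMeasurable_inner : ∀ y, AEStronglyMeasurable (fun z => ⟪v z, y⟫_ℂ) μ
  integrable_norm_sq : Integrable (fun z => ‖v z‖ ^ 2) μ
  inner_apply : ∀ x y, ⟪x, T y⟫_ℂ = ∫ z, ⟪x, v z⟫_ℂ * ⟪v z, y⟫_ℂ ∂μ

namespace IsRankOneIntegral

theorem aestronglyMeasurable_inner' (h : IsRankOneIntegral μ v T) (x : H) :
    AEStronglyMeasurable (fun z => ⟪x, v z⟫_ℂ) μ := by
  have := Complex.continuous_conj.comp_aestronglyMeasurable (h.aestronglyMeasurable_inner x)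
  simpa [Function.comp_def] using this

theorem integrable_inner_mul_inner (h : IsRankOneIntegral μ v T) (x y : H) :
    Integrable (fun z => ⟪x, v z⟫_ℂ * ⟪v z, y⟫_ℂ) μ := by
  refine (h.integrable_norm_sq.const_mul (‖x‖ * ‖y‖)).mono'
    ((h.aestronglyMeasurable_inner' x).mul (h.aestronglyMeasurable_inner y)) (.of_forall fun z => ?_)
  rw [norm_mul]
  calc _ ≤ (‖x‖ * ‖v z‖) * (‖v z‖ * ‖y‖) := by
        gcongr <;> exact norm_inner_le_norm _ _
    _ = _ := by ring

theorem isSymmetric (h : IsRankOneIntegral μ v T) : (T : H →ₗ[ℂ] H).IsSymmetric := by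
  intro x y
  change ⟪T x, y⟫_ℂ = ⟪x, T y⟫_ℂ
  rw [← inner_conj_symm, h.inner_apply, h.inner_apply, ← integral_conj]
  refine integral_congr_ae (.of_forall fun z => ?_)
  simp [mul_comm]

theorem inner_apply_self (h : IsRankOneIntegral μ v T) (x : H) :
    ⟪x, T x⟫_ℂ = ((∫ z, ‖⟪v z, x⟫_ℂ‖ ^ 2 ∂μ : ℝ) : ℂ) := by
  rw [h.inner_apply, ← integral_complex_ofReal]
  refine integral_congr_ae (.of_forall fun z => ?_)
  change ⟪x, v z⟫_ℂ * ⟪v z, x⟫_ℂ = _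
  rw [← inner_conj_symm, Complex.conj_mul']
  simp

theorem integrable_norm_inner_sq (h : IsRankOneIntegral μ v T) (x : H) :
    Integrable (fun z => ‖⟪v z, x⟫_ℂ‖ ^ 2) μ := by
  refine (h.integrable_inner_mul_inner x x).norm.congr (.of_forall fun z => ?_)
  simp only [norm_mul]
  rw [norm_inner_symm, sq]

/-- Bessel's inequality under the integral sign; it bounds the trace of `T` by $\int\|v\|^2$. -/
theorem sum_integral_norm_inner_sq_le (h : IsRankOneIntegral μ v T) {e : ι → H}
    (he : Orthonormal ℂ e) (s : Finset ι) :
    ∑ i ∈ s, ∫ z, ‖⟪v z, e i⟫_ℂ‖ ^ 2 ∂μ ≤ ∫ z, ‖v z‖ ^ 2 ∂μ := by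
  rw [← integral_finsetSum _ fun i _ => h.integrable_norm_inner_sq _]
  refine integral_mono (integrable_finsetSum _ fun i _ => h.integrable_norm_inner_sq _)
    h.integrable_norm_sq fun z => ?_
  simp_rw [norm_inner_symm (v z)]
  exact he.sum_inner_products_le _

theorem integrable_norm_mul_sqrt (h : IsRankOneIntegral μ v T) (e : ι → H) (s : Finset ι) :
    Integrable (fun z => ‖v z‖ * √(‖v z‖ ^ 2 - ∑ i ∈ s, ‖⟪v z, e i⟫_ℂ‖ ^ 2)) μ := by
  have hn : AEStronglyMeasurable (fun z => ‖v z‖) μ := by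
    have := Real.continuous_sqrt.comp_aestronglyMeasurable h.integrable_norm_sq.1
    simpa [Function.comp_def] using this
  refine h.integrable_norm_sq.mono' (hn.mul (Real.continuous_sqrt.comp_aestronglyMeasurable ?_))
    (.of_forall fun z => ?_)
  · exact h.integrable_norm_sq.1.sub
      (integrable_finsetSum _ fun i _ => h.integrable_norm_inner_sq _).1
  · rw [Real.norm_of_nonneg (by positivity), sq ‖v z‖]
    refine mul_le_mul_of_nonneg_left ?_ (norm_nonneg _)
    rw [← sq]
    refine Real.sqrt_le_iff.mpr ⟨norm_nonneg _, ?_⟩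
    rw [sub_le_self_iff]
    positivity

theorem norm_apply_sub_le (h : IsRankOneIntegral μ v T) {e : ι → H}
    (he : Orthonormal ℂ e) (s : Finset ι) (x : H) :
    ‖T (x - ∑ i ∈ s, ⟪e i, x⟫_ℂ • e i)‖
      ≤ (∫ z, ‖v z‖ * √(‖v z‖ ^ 2 - ∑ i ∈ s, ‖⟪v z, e i⟫_ℂ‖ ^ 2) ∂μ) * ‖x‖ := by
  set p := x - ∑ i ∈ s, ⟪e i, x⟫_ℂ • e i with hp
  set g : Z → ℝ := fun z => ‖v z‖ * √(‖v z‖ ^ 2 - ∑ i ∈ s, ‖⟪v z, e i⟫_ℂ‖ ^ 2)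
  -- The weak formula is tested against `T p` itself; one factor `‖T p‖` is cancelled afterwards.
  have key : ‖T p‖ * ‖T p‖ ≤ ‖T p‖ * ((∫ z, g z ∂μ) * ‖x‖) := by
    rw [← sq, ← inner_self_eq_norm_sq (𝕜 := ℂ) (T p)]
    refine (Complex.re_le_norm _).trans ?_
    calc ‖⟪T p, T p⟫_ℂ‖ = ‖∫ z, ⟪T p, v z⟫_ℂ * ⟪v z, p⟫_ℂ ∂μ‖ := by rw [h.inner_apply]
      _ ≤ ∫ z, ‖T p‖ * (g z * ‖x‖) ∂μ := by
          refine norm_integral_le_of_norm_le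
            (((h.integrable_norm_mul_sqrt e s).mul_const _).const_mul _) (.of_forall fun z => ?_)
          rw [norm_mul]
          calc _ ≤ (‖T p‖ * ‖v z‖) * (√(‖v z‖ ^ 2 - ∑ i ∈ s, ‖⟪v z, e i⟫_ℂ‖ ^ 2) * ‖x‖) := by
                gcongr
                · exact norm_inner_le_norm _ _
                · exact he.norm_inner_sub_sum_le s _ _
            _ = _ := by ring
      _ = _ := by rw [integral_const_mul, integral_mul_const]
  rcases (norm_nonneg (T p)).eq_or_lt with h0 | h0
  · rw [← h0]
    have : 0 ≤ ∫ z, g z ∂μ := integral_nonneg fun z => by positivity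
    positivity
  · exact le_of_mul_le_mul_left key h0

/-- By Parseval the remainder tends to zero at every `z`, and $\|v_z\|^2$ is an integrable majorant.
-/
theorem tendsto_integral_norm_mul_sqrt [CompleteSpace H] [TopologicalSpace.SeparableSpace H]
    (h : IsRankOneIntegral μ v T) (b : HilbertBasis ι ℂ H) :
    Tendsto (fun s => ∫ z, ‖v z‖ * √(‖v z‖ ^ 2 - ∑ i ∈ s, ‖⟪v z, b i⟫_ℂ‖ ^ 2) ∂μ) atTop (𝓝 0) := by
  have := b.orthonormal.countable
  rw [← integral_zero Z ℝ (μ := μ)]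
  refine tendsto_integral_filter_of_dominated_convergence (fun z => ‖v z‖ ^ 2)
    (.of_forall fun s => (h.integrable_norm_mul_sqrt b s).1)
    (.of_forall fun s => .of_forall fun z => ?_) h.integrable_norm_sq (.of_forall fun z => ?_)
  · rw [Real.norm_of_nonneg (by positivity), sq ‖v z‖]
    refine mul_le_mul_of_nonneg_left ?_ (norm_nonneg _)
    rw [← sq]
    refine Real.sqrt_le_iff.mpr ⟨norm_nonneg _, ?_⟩
    rw [sub_le_self_iff]
    positivity
  · have h1 : Tendsto (fun s => ∑ i ∈ s, ‖⟪v z, b i⟫_ℂ‖ ^ 2) atTop (𝓝 (‖v z‖ ^ 2)) := by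
      have h2 := (Complex.continuous_re.tendsto _).comp (b.hasSum_inner_mul_inner (v z) (v z))
      have h0 : ⟪v z, v z⟫_ℂ = ((‖v z‖ ^ 2 : ℝ) : ℂ) := by simp [inner_self_eq_norm_sq_to_K]
      rw [h0, Complex.ofReal_re] at h2
      convert h2 using 1
      · ext s
        simp only [Function.comp_apply, Complex.re_sum]
        refine Finset.sum_congr rfl fun i _ => ?_
        rw [← inner_conj_symm (b i), Complex.mul_conj']
        norm_cast
      · simp
    have h2 := ((h1.const_sub (‖v z‖ ^ 2)).sqrt).const_mul ‖v z‖
    simpa using h2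

/-- With $P_s$ the projection onto the span of $(b_i)_{i\in s}$, the finite-rank operators
$TP_s=\sum_{i\in s}|Tb_i\rangle\langle b_i|$ converge to `T` in norm, by the two preceding
estimates. -/
theorem isCompactOperator [CompleteSpace H] [TopologicalSpace.SeparableSpace H]
    (h : IsRankOneIntegral μ v T) : IsCompactOperator T := by
  obtain ⟨w, b, -⟩ := exists_hilbertBasis ℂ H
  let R : w → H →L[ℂ] H := fun i =>
    (ContinuousLinearMap.toSpanSingleton ℂ (T (b i))).comp (innerSL ℂ (b i))
  have hR : ∀ i, R i ∈ compactOperator (RingHom.id ℂ) H H := fun i =>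
    (isCompactOperator_of_locallyCompactSpace_dom (innerSL ℂ (b i))).clm_comp
      (ContinuousLinearMap.toSpanSingleton ℂ (T (b i)))
  refine isCompactOperator_of_tendsto (l := atTop) (F := fun s => ∑ i ∈ s, R i) ?_
    (.of_forall fun s => (compactOperator (RingHom.id ℂ) H H).sum_mem fun i _ => hR i)
  rw [tendsto_iff_norm_sub_tendsto_zero]
  refine squeeze_zero (fun _ => norm_nonneg _) (fun s => ?_) (h.tendsto_integral_norm_mul_sqrt b)
  refine ContinuousLinearMap.opNorm_le_bound _ (integral_nonneg fun z => by positivity) fun x => ?_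
  refine le_of_eq_of_le ?_ (h.norm_apply_sub_le b.orthonormal s x)
  rw [← norm_neg]
  simp [R]

end IsRankOneIntegral
end RankOneIntegral

/-! ### Fredholm series of the Gram kernel in a diagonalizing basis. -/

section FredholmSeries

open Filter Topology
open scoped InnerProductSpace

/-- Every term of the Leibniz formula meets each index once as row and once as column. The factor
$\ell!$ is harmless: this bound is only used for dominated convergence at fixed `ℓ`. -/
theorem Matrix.norm_det_le_of_norm_le_mul {ℓ : ℕ} {M : Matrix (Fin ℓ) (Fin ℓ) ℂ} {a : Fin ℓ → ℝ}
    (hM : ∀ j k, ‖M j k‖ ≤ a j * a k) : ‖M.det‖ ≤ ℓ.factorial * ∏ j, a j ^ 2 := by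
  rw [Matrix.det_apply']
  refine (norm_sum_le_of_le (n := fun _ => ∏ j, a j ^ 2) _ fun π _ => ?_).trans ?_
  · rw [norm_mul, norm_prod]
    have h1 : ‖((Equiv.Perm.sign π : ℤ) : ℂ)‖ = 1 := by
      rcases Int.units_eq_one_or (Equiv.Perm.sign π) with h | h <;> simp [h]
    rw [h1, one_mul]
    calc ∏ i, ‖M (π i) i‖ ≤ ∏ i, a (π i) * a i :=
          Finset.prod_le_prod (fun _ _ => norm_nonneg _) fun i _ => hM _ _
      _ = ∏ j, a j ^ 2 := by
          rw [Finset.prod_mul_distrib, Equiv.prod_comp π a, ← Finset.prod_mul_distrib]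
          simp [sq]
  · simp [Fintype.card_perm]

variable {ι : Type*}

theorem Finset.card_injective_image_eq [DecidableEq ι] {ℓ : ℕ} {s t : Finset ι}
    (ht : t ∈ s.powersetCard ℓ) :
    (((Fintype.piFinset fun _ : Fin ℓ => s).filter Function.Injective).filter
      fun m => Finset.univ.image m = t).card = ℓ.factorial := by
  rw [Finset.mem_powersetCard] at ht
  have hc : Fintype.card (Fin ℓ) = Fintype.card t := by simp [ht.2]
  calc _ = (Finset.univ : Finset (Fin ℓ ≃ t)).card := by
        symm
        refine Finset.card_bij (fun f _ j => (f j : ι)) (fun f _ => ?_) (fun f _ g _ h => ?_)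
          fun m hm => ?_
        · simp only [Finset.mem_filter, Fintype.mem_piFinset]
          refine ⟨⟨fun j => ht.1 (f j).2, Subtype.val_injective.comp f.injective⟩, ?_⟩
          ext i
          simp only [Finset.mem_image, Finset.mem_univ, true_and]
          refine ⟨?_, fun hi => ⟨f.symm ⟨i, hi⟩, by simp⟩⟩
          rintro ⟨j, rfl⟩
          exact (f j).2
        · ext j
          exact congr_fun h j
        · simp only [Finset.mem_filter, Fintype.mem_piFinset] at hm
          have hmt : ∀ j, m j ∈ t := fun j => by
            rw [← hm.2]
            exact Finset.mem_image_of_mem _ (Finset.mem_univ _)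
          refine ⟨Equiv.ofBijective (fun j => ⟨m j, hmt j⟩)
            ((Fintype.bijective_iff_injective_and_card _).mpr ⟨fun i j hij => ?_, hc⟩), by simp, rfl⟩
          exact hm.1.2 (congrArg Subtype.val hij)
    _ = ℓ.factorial := by
        rw [Finset.card_univ, Fintype.card_equiv (Fintype.equivOfCardEq hc), Fintype.card_fin]

theorem Finset.sum_injective_prod [DecidableEq ι] (s : Finset ι) (ℓ : ℕ) (a : ι → ℂ) :
    ∑ m ∈ (Fintype.piFinset fun _ : Fin ℓ => s).filter Function.Injective, ∏ j, a (m j)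
      = ℓ.factorial * ∑ t ∈ s.powersetCard ℓ, ∏ i ∈ t, a i := by
  rw [← Finset.sum_fiberwise_of_maps_to (t := s.powersetCard ℓ)
    (g := fun m => Finset.univ.image m), Finset.mul_sum]
  · refine Finset.sum_congr rfl fun t ht => ?_
    rw [← Finset.card_injective_image_eq ht, ← nsmul_eq_mul]
    refine Finset.sum_eq_card_nsmul fun m hm => ?_
    simp only [Finset.mem_filter] at hm
    rw [← hm.2, Finset.prod_image hm.1.2.injOn]
  · intro m hm
    simp only [Finset.mem_filter, Fintype.mem_piFinset] at hm
    rw [Finset.mem_powersetCard, Finset.card_image_of_injective _ hm.2]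
    refine ⟨?_, by simp⟩
    rw [Finset.image_subset_iff]
    exact fun j _ => hm.1 j

theorem Matrix.det_ite_eq [DecidableEq ι] {ℓ : ℕ} (a : ι → ℂ) (m : Fin ℓ → ι) :
    (Matrix.of fun j k => if m j = m k then a (m j) else 0).det
      = if Function.Injective m then ∏ j, a (m j) else 0 := by
  split_ifs with hm
  · rw [← Matrix.det_diagonal]
    congr 1
    ext j k
    simp [Matrix.diagonal_apply, hm.eq_iff]
  · simp only [Function.Injective, not_forall] at hm
    obtain ⟨i, j, hij, hne⟩ := hm
    refine Matrix.det_zero_of_row_eq hne ?_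
    ext k
    simp [hij]

/-- Expansion in elementary symmetric polynomials, each written as a sum over injective tuples
divided by $\ell!$. Only finitely many terms are non-zero; the form `∑'` allows a termwise
comparison with the Fredholm series. -/
theorem Finset.prod_one_sub_eq_tsum [DecidableEq ι] (s : Finset ι) (a : ι → ℂ) :
    ∏ i ∈ s, (1 - a i)
      = ∑' ℓ : ℕ, (-1) ^ ℓ / (ℓ.factorial : ℂ) *
          ∑ m ∈ (Fintype.piFinset fun _ : Fin ℓ => s).filter Function.Injective, ∏ j, a (m j) := by
  have h : ∀ ℓ : ℕ, (-1) ^ ℓ / (ℓ.factorial : ℂ) *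
      ∑ m ∈ (Fintype.piFinset fun _ : Fin ℓ => s).filter Function.Injective, ∏ j, a (m j)
      = ∑ t ∈ s.powersetCard ℓ, ∏ i ∈ t, -a i := fun ℓ => by
    rw [Finset.sum_injective_prod, ← mul_assoc, div_mul_cancel₀ _ (by exact_mod_cast ℓ.factorial_ne_zero),
      Finset.mul_sum]
    refine Finset.sum_congr rfl fun t ht => ?_
    rw [Finset.prod_neg, (Finset.mem_powersetCard.mp ht).2]
  simp_rw [h, sub_eq_add_neg]
  rw [Finset.prod_one_add, Finset.sum_powerset, tsum_eq_sum]
  intro ℓ hℓ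
  rw [Finset.powersetCard_eq_empty.mpr, Finset.sum_empty]
  simpa using hℓ

theorem Finset.norm_sum_injective_prod_le [DecidableEq ι] (s : Finset ι) (ℓ : ℕ) (a : ι → ℂ) :
    ‖∑ m ∈ (Fintype.piFinset fun _ : Fin ℓ => s).filter Function.Injective, ∏ j, a (m j)‖
      ≤ (∑ i ∈ s, ‖a i‖) ^ ℓ := by
  refine (norm_sum_le _ _).trans ?_
  rw [Finset.sum_pow']
  simp_rw [norm_prod]
  exact Finset.sum_le_sum_of_subset_of_nonneg (Finset.filter_subset _ _)
    fun _ _ _ => Finset.prod_nonneg fun _ _ => norm_nonneg _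

variable {Z H : Type*} [NormedAddCommGroup H] [InnerProductSpace ℂ H]

/-- A Cauchy–Binet type expansion, arranged so that each factor depends on a single `z j` and the
integral over the product measure factorizes. -/
theorem det_truncatedKernel (v : Z → H) (e : ι → H) (s : Finset ι) {ℓ : ℕ} (z : Fin ℓ → Z) :
    (Matrix.of fun j k => truncatedKernel v e s (z j) (z k)).det
      = ∑ m ∈ Fintype.piFinset fun _ : Fin ℓ => s, ∑ π : Equiv.Perm (Fin ℓ),
          ((Equiv.Perm.sign π : ℤ) : ℂ) *
            ∏ j, (⟪e (m j), v (z j)⟫_ℂ * ⟪v (z j), e (m (π j))⟫_ℂ) := by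
  rw [Finset.sum_comm, Matrix.det_apply']
  -- Passing to the inverse permutation brings both factors containing `z j` together.
  refine Fintype.sum_equiv (Equiv.inv _) _ _ fun σ => ?_
  simp only [Matrix.of_apply, truncatedKernel, Equiv.inv_apply, Equiv.Perm.sign_inv]
  rw [Finset.prod_univ_sum, Finset.mul_sum]
  refine Finset.sum_congr rfl fun m _ => ?_
  rw [Finset.prod_mul_distrib, Finset.prod_mul_distrib, mul_comm (∏ j, ⟪e (m j), v (z j)⟫_ℂ),
    ← Equiv.prod_comp σ fun j => ⟪v (z j), e (m (σ⁻¹ j))⟫_ℂ]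
  simp

theorem tendsto_det_truncatedKernel [CompleteSpace H] (v : Z → H) (b : HilbertBasis ι ℂ H) {ℓ : ℕ} (z : Fin ℓ → Z) :
    Tendsto (fun s => (Matrix.of fun j k => truncatedKernel v b s (z j) (z k)).det) atTop
      (𝓝 (Matrix.of fun j k => ⟪v (z j), v (z k)⟫_ℂ).det) := by
  refine (Continuous.matrix_det continuous_id).continuousAt.tendsto.comp ?_
  exact tendsto_pi_nhds.mpr fun j => tendsto_pi_nhds.mpr fun k => tendsto_truncatedKernel b _ _

variable [MeasurableSpace Z] {μ : Measure Z} {v : Z → H} {T : H →L[ℂ] H}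

namespace IsRankOneIntegral

/-- The diagonal entries are integrals of squares, hence non-negative, so the trace bound controls
their absolute values. -/
theorem sum_norm_le (h : IsRankOneIntegral μ v T) {e : ι → H} (he : Orthonormal ℂ e)
    {a : ι → ℂ} (hd : ∀ i, ⟪e i, T (e i)⟫_ℂ = a i) (s : Finset ι) :
    ∑ i ∈ s, ‖a i‖ ≤ ∫ z, ‖v z‖ ^ 2 ∂μ := by
  refine le_of_eq_of_le (Finset.sum_congr rfl fun i _ => ?_)
    (h.sum_integral_norm_inner_sq_le he s)
  rw [← hd, h.inner_apply_self, Complex.norm_real, Real.norm_of_nonneg]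
  exact integral_nonneg fun z => by positivity

theorem summable_norm (h : IsRankOneIntegral μ v T) {e : ι → H} (he : Orthonormal ℂ e)
    {a : ι → ℂ} (hd : ∀ i, ⟪e i, T (e i)⟫_ℂ = a i) : Summable fun i => ‖a i‖ :=
  summable_of_sum_le (fun _ => norm_nonneg _) (h.sum_norm_le he hd)

variable [SigmaFinite μ]

theorem integrable_det_truncatedKernel (h : IsRankOneIntegral μ v T) (e : ι → H) (s : Finset ι)
    (ℓ : ℕ) : Integrable (fun z : Fin ℓ → Z =>
      (Matrix.of fun j k => truncatedKernel v e s (z j) (z k)).det) (Measure.pi fun _ => μ) := by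
  simp_rw [det_truncatedKernel]
  exact integrable_finsetSum _ fun m _ => integrable_finsetSum _ fun π _ =>
    (Integrable.fintype_prod (f := fun j w => ⟪e (m j), v w⟫_ℂ * ⟪v w, e (m (π j))⟫_ℂ)
      fun j => h.integrable_inner_mul_inner _ _).const_mul _

theorem integral_det_truncatedKernel (h : IsRankOneIntegral μ v T) (e : ι → H) (s : Finset ι)
    (ℓ : ℕ) : ∫ z : Fin ℓ → Z,
      (Matrix.of fun j k => truncatedKernel v e s (z j) (z k)).det ∂(Measure.pi fun _ => μ)
      = ∑ m ∈ Fintype.piFinset fun _ : Fin ℓ => s,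
          (Matrix.of fun j k => ⟪e (m j), T (e (m k))⟫_ℂ).det := by
  have hint : ∀ (m : Fin ℓ → ι) (π : Equiv.Perm (Fin ℓ)), Integrable (fun z : Fin ℓ → Z =>
      ((Equiv.Perm.sign π : ℤ) : ℂ) * ∏ j, (⟪e (m j), v (z j)⟫_ℂ * ⟪v (z j), e (m (π j))⟫_ℂ))
      (Measure.pi fun _ => μ) := fun m π =>
    (Integrable.fintype_prod (f := fun j w => ⟪e (m j), v w⟫_ℂ * ⟪v w, e (m (π j))⟫_ℂ)
      fun j => h.integrable_inner_mul_inner _ _).const_mul _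
  simp_rw [det_truncatedKernel]
  rw [integral_finsetSum _ fun m _ => integrable_finsetSum _ fun π _ => hint m π]
  refine Finset.sum_congr rfl fun m _ => ?_
  rw [integral_finsetSum _ fun π _ => hint m π, ← Matrix.det_transpose, Matrix.det_apply']
  refine Finset.sum_congr rfl fun π _ => ?_
  rw [integral_const_mul,
    integral_fintype_prod_eq_prod fun j w => ⟪e (m j), v w⟫_ℂ * ⟪v w, e (m (π j))⟫_ℂ]
  simp_rw [← h.inner_apply]
  rfl

theorem integral_det_truncatedKernel_of_diagonal [DecidableEq ι] (h : IsRankOneIntegral μ v T)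
    {e : ι → H} {a : ι → ℂ} (hd : ∀ i j, ⟪e i, T (e j)⟫_ℂ = if i = j then a i else 0)
    (s : Finset ι) (ℓ : ℕ) : ∫ z : Fin ℓ → Z,
      (Matrix.of fun j k => truncatedKernel v e s (z j) (z k)).det ∂(Measure.pi fun _ => μ)
      = ∑ m ∈ (Fintype.piFinset fun _ : Fin ℓ => s).filter Function.Injective, ∏ j, a (m j) := by
  simp_rw [h.integral_det_truncatedKernel, hd, Matrix.det_ite_eq, Finset.sum_filter]

theorem integrable_prod_norm_sq (h : IsRankOneIntegral μ v T) (ℓ : ℕ) :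
    Integrable (fun z : Fin ℓ → Z => (ℓ.factorial : ℝ) * ∏ j, ‖v (z j)‖ ^ 2)
      (Measure.pi fun _ => μ) :=
  (Integrable.fintype_prod (f := fun _ w => ‖v w‖ ^ 2) fun _ => h.integrable_norm_sq).const_mul _

section

variable [CompleteSpace H]

variable [TopologicalSpace.SeparableSpace H]

theorem integrable_det (h : IsRankOneIntegral μ v T) (ℓ : ℕ) :
    Integrable (fun z : Fin ℓ → Z => (Matrix.of fun j k => ⟪v (z j), v (z k)⟫_ℂ).det)
      (Measure.pi fun _ => μ) := by
  obtain ⟨w, b, -⟩ := exists_hilbertBasis ℂ H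
  have := b.orthonormal.countable
  refine (h.integrable_prod_norm_sq ℓ).mono' (aestronglyMeasurable_of_tendsto_ae atTop
    (fun s => (h.integrable_det_truncatedKernel b s ℓ).1)
    (.of_forall fun z => tendsto_det_truncatedKernel v b z)) (.of_forall fun z => ?_)
  exact Matrix.norm_det_le_of_norm_le_mul fun j k => norm_inner_le_norm _ _

theorem tendsto_integral_det (h : IsRankOneIntegral μ v T) (b : HilbertBasis ι ℂ H) (ℓ : ℕ) :
    Tendsto (fun s => ∫ z : Fin ℓ → Z,
      (Matrix.of fun j k => truncatedKernel v b s (z j) (z k)).det ∂(Measure.pi fun _ => μ)) atTop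
      (𝓝 (∫ z : Fin ℓ → Z, (Matrix.of fun j k => ⟪v (z j), v (z k)⟫_ℂ).det
        ∂(Measure.pi fun _ => μ))) := by
  have := b.orthonormal.countable
  refine tendsto_integral_filter_of_dominated_convergence _
    (.of_forall fun s => (h.integrable_det_truncatedKernel b s ℓ).1)
    (.of_forall fun s => .of_forall fun z => ?_) (h.integrable_prod_norm_sq ℓ)
    (.of_forall fun z => tendsto_det_truncatedKernel v b z)
  exact Matrix.norm_det_le_of_norm_le_mul fun j k => norm_truncatedKernel_le b.orthonormal s _ _

variable {b : HilbertBasis ι ℂ H} {a : ι → ℂ}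

/-- The bound has no $\ell!$ because it is inherited from the truncated integrals, which are sums
over injective tuples. Divided by $\ell!$ it is a term of an exponential series. -/
theorem norm_integral_det_le [DecidableEq ι] (h : IsRankOneIntegral μ v T)
    (hd : ∀ i j, ⟪b i, T (b j)⟫_ℂ = if i = j then a i else 0) (ℓ : ℕ) :
    ‖∫ z : Fin ℓ → Z, (Matrix.of fun j k => ⟪v (z j), v (z k)⟫_ℂ).det ∂(Measure.pi fun _ => μ)‖
      ≤ (∫ z, ‖v z‖ ^ 2 ∂μ) ^ ℓ := by
  refine le_of_tendsto (h.tendsto_integral_det b ℓ).norm (.of_forall fun s => ?_)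
  rw [h.integral_det_truncatedKernel_of_diagonal hd]
  refine (Finset.norm_sum_injective_prod_le s ℓ a).trans ?_
  gcongr
  exact h.sum_norm_le b.orthonormal (fun i => by simp [hd]) s

theorem summable_fredholm_term [DecidableEq ι] (h : IsRankOneIntegral μ v T)
    (hd : ∀ i j, ⟪b i, T (b j)⟫_ℂ = if i = j then a i else 0) :
    Summable fun ℓ : ℕ => (-1) ^ ℓ / (ℓ.factorial : ℂ) * ∫ z : Fin ℓ → Z,
      (Matrix.of fun j k => ⟪v (z j), v (z k)⟫_ℂ).det ∂(Measure.pi fun _ => μ) := by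
  refine .of_norm_bounded (Real.summable_pow_div_factorial (∫ z, ‖v z‖ ^ 2 ∂μ)) fun ℓ => ?_
  rw [norm_mul, norm_div, norm_pow, norm_neg, norm_one, one_pow, Complex.norm_natCast,
    div_mul_eq_mul_div, one_mul]
  gcongr
  exact h.norm_integral_det_le hd ℓ

theorem hasProd_one_sub [DecidableEq ι] (h : IsRankOneIntegral μ v T)
    (hd : ∀ i j, ⟪b i, T (b j)⟫_ℂ = if i = j then a i else 0) :
    HasProd (fun i => 1 - a i) (∑' ℓ : ℕ, (-1) ^ ℓ / (ℓ.factorial : ℂ) * ∫ z : Fin ℓ → Z,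
      (Matrix.of fun j k => ⟪v (z j), v (z k)⟫_ℂ).det ∂(Measure.pi fun _ => μ)) := by
  -- Unconditional convergence is the limit along finite sets `s`, so only the exchange of this
  -- limit with the sum over `ℓ` remains.
  simp only [HasProd, SummationFilter.unconditional_filter, Finset.prod_one_sub_eq_tsum]
  refine tendsto_tsum_of_dominated_convergence
    (Real.summable_pow_div_factorial (∫ z, ‖v z‖ ^ 2 ∂μ)) (fun ℓ => ?_)
    (.of_forall fun s ℓ => ?_)
  · refine Tendsto.const_mul _ ?_
    simp_rw [← h.integral_det_truncatedKernel_of_diagonal hd]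
    exact h.tendsto_integral_det b ℓ
  · rw [norm_mul, norm_div, norm_pow, norm_neg, norm_one, one_pow, Complex.norm_natCast,
      div_mul_eq_mul_div, one_mul]
    gcongr
    refine (Finset.norm_sum_injective_prod_le s ℓ a).trans ?_
    gcongr
    exact h.sum_norm_le b.orthonormal (fun i => by simp [hd]) s

end

end IsRankOneIntegral

end FredholmSeries

/-! ### Spectral theorem with non-zero eigenvalues listed by multiplicity. -/

section Spectrum

open scoped InnerProductSpace

variable {H : Type*} [NormedAddCommGroup H] [InnerProductSpace ℂ H] {T : H →L[ℂ] H}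

/-- Symmetric operators are semisimple, so algebraic and geometric multiplicities agree. -/
theorem LinearMap.IsSymmetric.maxGenEigenspace_eq (hs : (T : H →ₗ[ℂ] H).IsSymmetric) (z : ℂ) :
    Module.End.maxGenEigenspace (T : Module.End ℂ H) z
      = Module.End.eigenspace (T : Module.End ℂ H) z :=
  hs.isFinitelySemisimple.maxGenEigenspace_eq_eigenspace z

theorem IsCompactOperator.finiteDimensional_maxGenEigenspace [CompleteSpace H]
    (hc : IsCompactOperator T) (hs : (T : H →ₗ[ℂ] H).IsSymmetric) {z : ℂ} (hz : z ≠ 0) :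
    FiniteDimensional ℂ (Module.End.maxGenEigenspace (T : Module.End ℂ H) z) := by
  rw [hs.maxGenEigenspace_eq]
  exact T.finite_dimensional_eigenspace hc z hz

/-- A compact symmetric operator has an orthonormal family of eigenvectors, indexed by the non-zero
eigenvalues with multiplicity, whose orthogonal complement is contained in the kernel. -/
theorem IsCompactOperator.exists_orthonormal_eigenvectors [CompleteSpace H]
    (hc : IsCompactOperator T) (hs : (T : H →ₗ[ℂ] H).IsSymmetric) :
    ∃ e : NonzeroEigenvalueIndex T → H, Orthonormal ℂ e ∧
      (∀ i, T (e i) = nonzeroEigenvalue T i • e i) ∧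
      ∀ x, (∀ i, ⟪e i, x⟫_ℂ = 0) → T x = 0 := by
  let I := {z : ℂ // z ≠ 0 ∧ Module.End.HasEigenvalue (T : Module.End ℂ H) z}
  let V : I → Submodule ℂ H := fun z => Module.End.maxGenEigenspace (T : Module.End ℂ H) z
  have hfd : ∀ z : I, FiniteDimensional ℂ (V z) := fun z =>
    hc.finiteDimensional_maxGenEigenspace hs z.2.1
  have hV : OrthogonalFamily ℂ (fun z => V z) fun z => (V z).subtypeₗᵢ := by
    refine OrthogonalFamily.of_pairwise fun z w hzw => ?_
    simp only [V, hs.maxGenEigenspace_eq]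
    exact hs.orthogonalFamily_eigenspaces.isOrtho (fun h => hzw (Subtype.ext h))
  let B : ∀ z : I, OrthonormalBasis (Fin (algMultiplicity T z)) ℂ (V z) := fun z =>
    stdOrthonormalBasis ℂ (V z)
  let e : NonzeroEigenvalueIndex T → H := fun i => (B i.1 i.2 : H)
  have hmem : ∀ (z : I) (x : V z), T x = (z : ℂ) • (x : H) := fun z x => by
    have := x.2
    simp only [V, hs.maxGenEigenspace_eq] at this
    exact Module.End.mem_eigenspace_iff.mp this
  have he : Orthonormal ℂ e := hV.orthonormal_sigma_orthonormal fun z => (B z).orthonormal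
  refine ⟨e, he, fun i => hmem i.1 (B i.1 i.2), fun x hx => ?_⟩
  have hx' : ∀ z : ℂ, z ≠ 0 → ∀ y ∈ Module.End.eigenspace (T : Module.End ℂ H) z,
      ⟪y, x⟫_ℂ = 0 := fun z hz y hy => by
    by_cases hev : Module.End.HasEigenvalue (T : Module.End ℂ H) z
    · let z' : I := ⟨z, hz, hev⟩
      have hy' : y ∈ V z' := by simpa only [V, hs.maxGenEigenspace_eq] using hy
      have hsum := congrArg Subtype.val ((B z').sum_repr ⟨y, hy'⟩)
      simp only [AddSubmonoidClass.coe_finsetSum, Submodule.coe_smul] at hsum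
      rw [← hsum, sum_inner]
      refine Finset.sum_eq_zero fun i _ => ?_
      rw [inner_smul_left]
      exact mul_eq_zero_of_right _ (hx ⟨z', i⟩)
    · rw [Module.End.hasEigenvalue_iff, not_not] at hev
      have : y = 0 := by rwa [hev, Submodule.mem_bot] at hy
      simp [this]
  -- `T x` is orthogonal to every eigenspace, including the one for zero, where $\langle
  -- y,Tx\rangle=\langle Ty,x\rangle=0$. The eigenspaces of a compact symmetric operator have
  -- trivial common orthogonal complement.
  have hT : T x ∈ (⨆ z, Module.End.eigenspace (T : Module.End ℂ H) z)ᗮ := by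
    rw [← Submodule.iInf_orthogonal, Submodule.mem_iInf]
    intro z y hy
    have hy' : T y = z • y := Module.End.mem_eigenspace_iff.mp hy
    have : ⟪y, T x⟫_ℂ = ⟪T y, x⟫_ℂ := (hs y x).symm
    rw [this, hy', inner_smul_left]
    by_cases hz : z = 0
    · simp [hz]
    · rw [hx' z hz y hy, mul_zero]
  rw [T.orthogonalComplement_iSup_eigenspaces_eq_bot hc hs] at hT
  exact (Submodule.mem_bot ℂ).mp hT

end Spectrum

/-! ### The determinant as a product over the non-zero eigenvalues. -/

section

open scoped InnerProductSpace

variable {Z H : Type*} [NormedAddCommGroup H] [InnerProductSpace ℂ H] [CompleteSpace H]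
  [TopologicalSpace.SeparableSpace H] [MeasurableSpace Z] {μ : Measure Z}
  {v : Z → H} {T : H →L[ℂ] H}

namespace IsRankOneIntegral

theorem summable_norm_nonzeroEigenvalue (h : IsRankOneIntegral μ v T) :
    Summable fun i => ‖nonzeroEigenvalue T i‖ := by
  obtain ⟨e, he, hTe, -⟩ := h.isCompactOperator.exists_orthonormal_eigenvectors h.isSymmetric
  refine h.summable_norm he fun i => ?_
  rw [hTe, inner_smul_right, inner_self_eq_norm_sq_to_K, he.norm_eq_one]
  simp

/-- The eigenvectors for non-zero eigenvalues are completed to a Hilbert basis. The added vectors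
are orthogonal to them, hence lie in the kernel and get the value zero. -/
theorem exists_hilbertBasis (h : IsRankOneIntegral μ v T) :
    ∃ (w : Set H) (b : HilbertBasis w ℂ H) (a : w → ℂ) (f : NonzeroEigenvalueIndex T → w),
      (∀ x, T (b x) = a x • b x) ∧ Function.Injective f ∧
      (∀ i, a (f i) = nonzeroEigenvalue T i) ∧ ∀ x ∉ Set.range f, a x = 0 := by
  obtain ⟨e, he, hTe, hker⟩ := h.isCompactOperator.exists_orthonormal_eigenvectors h.isSymmetric
  obtain ⟨w, b, hw, hb⟩ := he.toSubtypeRange.exists_hilbertBasis_extension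
  let f : NonzeroEigenvalueIndex T → w := fun i => ⟨e i, hw ⟨i, rfl⟩⟩
  have hf : Function.Injective f := fun i j hij =>
    he.linearIndependent.injective (congrArg Subtype.val hij)
  have hbf : ∀ i, b (f i) = e i := fun i => by rw [hb]
  classical
  refine ⟨w, b, Function.extend f (nonzeroEigenvalue T) 0, f, fun x => ?_, hf,
    fun i => hf.extend_apply _ _ i, fun x hx => Function.extend_apply' _ _ _ hx⟩
  by_cases hx : x ∈ Set.range f
  · obtain ⟨i, rfl⟩ := hx
    rw [hf.extend_apply, hbf, hTe]
  · rw [Function.extend_apply' _ _ _ hx, Pi.zero_apply, zero_smul]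
    refine hker _ fun i => ?_
    rw [← hbf]
    exact b.orthonormal.inner_eq_zero fun hi => hx ⟨i, hi⟩

variable [SigmaFinite μ]

/-- The determinant of `1 - T`: the Fredholm series of the kernel `⟪v z, v w⟫` converges to the
product of the numbers `1 - λ` over the non-zero eigenvalues `λ` of `T`. -/
theorem summable_and_hasProd (h : IsRankOneIntegral μ v T) :
    (Summable fun ℓ : ℕ => (-1) ^ ℓ / (ℓ.factorial : ℂ) * ∫ z : Fin ℓ → Z,
      (Matrix.of fun j k => ⟪v (z j), v (z k)⟫_ℂ).det ∂(Measure.pi fun _ => μ)) ∧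
    HasProd (fun i => 1 - nonzeroEigenvalue T i)
      (∑' ℓ : ℕ, (-1) ^ ℓ / (ℓ.factorial : ℂ) * ∫ z : Fin ℓ → Z,
        (Matrix.of fun j k => ⟪v (z j), v (z k)⟫_ℂ).det ∂(Measure.pi fun _ => μ)) := by
  classical
  obtain ⟨w, b, a, f, hTb, hf, hfa, hf0⟩ := h.exists_hilbertBasis
  have hd : ∀ i j, ⟪b i, T (b j)⟫_ℂ = if i = j then a i else 0 := fun i j => by
    rw [hTb, inner_smul_right, orthonormal_iff_ite.mp b.orthonormal]
    by_cases hij : i = j <;> simp [hij]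
  refine ⟨h.summable_fredholm_term hd, ?_⟩
  rw [← funext fun i => congrArg (1 - ·) (hfa i)]
  exact (hf.hasProd_iff fun x hx => by simp [hf0 x hx]).mpr (h.hasProd_one_sub hd)

end IsRankOneIntegral

end

/-! ### Coherent states factorizing both kernels. -/

section CoherentStates

open scoped InnerProductSpace ComplexConjugate

/-- The kernel of the square root of the Gaussian-damped sine kernel: both `K_sin^σ` and `S_t^σ`
are compositions of the operator with this kernel and its adjoint. -/
noncomputable def coherentState (σ t : ℝ) (z : ℂ) (a : ℝ) : ℂ :=
  ((√(1 / (2 * t * σ * √Real.pi))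
      * Real.exp (-z.im ^ 2 / (2 * σ ^ 2) - (σ * (Real.pi * a / t)) ^ 2 / 2) : ℝ) : ℂ)
    * Complex.exp (-((Real.pi * a / t : ℝ) * conj z) * Complex.I)

theorem Continuous.coherentState {X : Type*} [TopologicalSpace X] {f : X → ℂ} {g : X → ℝ}
    (hf : Continuous f) (hg : Continuous g) (σ t : ℝ) :
    Continuous fun x => coherentState σ t (f x) (g x) := by
  unfold _root_.coherentState
  fun_prop

/-- A bound uniform in `a` and Gaussian in `z.im`. With $u=\pi a/t$, $Y=\operatorname{Im}z/\sigma$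
and $U=\sigma u$, the exponent is $-Y^2/2-U^2/2-UY$. Half of the decay in $Y$ absorbs the cross
term, since $-UY\le Y^2/4+U^2$, and $|u|\le\pi$. -/
theorem norm_coherentState_le {σ t a : ℝ} (hσ : 0 < σ) (ht : 0 < t) (ha : a ∈ Set.Ioo (-t) t)
    (z : ℂ) : ‖coherentState σ t z a‖ ≤ √(1 / (2 * t * σ * √Real.pi))
      * Real.exp ((σ * Real.pi) ^ 2 / 2) * Real.exp (-(1 / (4 * σ ^ 2)) * z.im ^ 2) := by
  rw [coherentState, norm_mul, Complex.norm_real, Complex.norm_exp, Real.norm_eq_abs,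
    abs_of_nonneg (by positivity)]
  set A := √(1 / (2 * t * σ * √Real.pi))
  rw [mul_assoc A, mul_assoc A, ← Real.exp_add, ← Real.exp_add]
  refine mul_le_mul_of_nonneg_left (Real.exp_le_exp.mpr ?_) (Real.sqrt_nonneg _)
  set u := Real.pi * a / t with hu
  have hre : (-((u : ℂ) * conj z) * Complex.I).re = -(u * z.im) := by simp
  rw [hre]
  have hu2 : u ^ 2 ≤ Real.pi ^ 2 := by
    rw [hu, mul_div_assoc, mul_pow]
    refine mul_le_of_le_one_right (sq_nonneg _) ?_
    rw [div_pow, div_le_one (by positivity)]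
    exact sq_le_sq' ha.1.le ha.2.le
  have hy : z.im ^ 2 = σ ^ 2 * (z.im / σ) ^ 2 := by field_simp
  have h1 : -z.im ^ 2 / (2 * σ ^ 2) = -(z.im / σ) ^ 2 / 2 := by field_simp
  have h2 : -(1 / (4 * σ ^ 2)) * z.im ^ 2 = -(z.im / σ) ^ 2 / 4 := by field_simp
  have h3 : u * z.im = (σ * u) * (z.im / σ) := by field_simp
  rw [h1, h2, h3, mul_pow, mul_pow]
  nlinarith [sq_nonneg (z.im / σ + 2 * (σ * u)), mul_le_mul_of_nonneg_left hu2 (sq_nonneg σ)]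

theorem memLp_coherentState (σ t : ℝ) (hσ : 0 < σ) (ht : 0 < t) (z : ℂ) :
    MemLp (coherentState σ t z) 2 (volume.restrict (Set.Ioo (-t) t)) := by
  refine MemLp.of_bound
    (continuous_const.coherentState continuous_id σ t).aestronglyMeasurable
    (√(1 / (2 * t * σ * √Real.pi)) * Real.exp ((σ * Real.pi) ^ 2 / 2)
      * Real.exp (-(1 / (4 * σ ^ 2)) * z.im ^ 2)) ?_
  filter_upwards [ae_restrict_mem measurableSet_Ioo] with a ha
  exact norm_coherentState_le hσ ht ha z

theorem measurePreserving_strip (t : ℝ) :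
    MeasurePreserving Complex.measurableEquivRealProd (volume.restrict (strip t))
      ((volume.restrict (Set.Ioo (-t) t)).prod volume) := by
  have h := Complex.volume_preserving_equiv_real_prod.restrict_preimage
    (s := Set.Ioo (-t) t ×ˢ Set.univ) (measurableSet_Ioo.prod MeasurableSet.univ)
  rw [Measure.volume_eq_prod, ← Measure.prod_restrict, Measure.restrict_univ] at h
  have hs : Complex.measurableEquivRealProd ⁻¹' (Set.Ioo (-t) t ×ˢ Set.univ) = strip t := by
    ext z
    simp [strip, Complex.measurableEquivRealProd_apply]
  rwa [hs] at h

theorem integrable_exp_strip (t : ℝ) {c : ℝ} (hc : 0 < c) :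
    Integrable (fun z : ℂ => Real.exp (-c * z.im ^ 2)) (volume.restrict (strip t)) := by
  have h : Integrable (fun p : ℝ × ℝ => (1 : ℝ) * Real.exp (-c * p.2 ^ 2))
      ((volume.restrict (Set.Ioo (-t) t)).prod volume) :=
    Integrable.mul_prod (f := fun _ : ℝ => (1 : ℝ)) (integrable_const _) (integrable_exp_neg_mul_sq hc)
  have := (measurePreserving_strip t).integrable_comp_of_integrable h
  simpa [Function.comp_def, Complex.measurableEquivRealProd_apply] using this

theorem integral_exp_quadratic {σ : ℝ} (hσ : 0 < σ) (c : ℝ) :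
    ∫ y : ℝ, Real.exp (-y ^ 2 / σ ^ 2 - c * y)
      = σ * √Real.pi * Real.exp (σ ^ 2 * c ^ 2 / 4) := by
  have h : ∀ y : ℝ, Real.exp (-y ^ 2 / σ ^ 2 - c * y)
      = Real.exp (-(1 / σ ^ 2) * (y + σ ^ 2 * c / 2) ^ 2) * Real.exp (σ ^ 2 * c ^ 2 / 4) := fun y => by
    rw [← Real.exp_add]
    congr 1
    field_simp
    ring
  simp_rw [h]
  rw [integral_mul_const, integral_add_right_eq_self fun y => Real.exp (-(1 / σ ^ 2) * y ^ 2),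
    integral_gaussian, div_div_eq_mul_div, div_one, Real.sqrt_mul Real.pi_pos.le,
    Real.sqrt_sq hσ.le, mul_comm σ]

theorem integral_exp_mul_I_Ioo {t : ℝ} (ht : 0 < t) (c : ℝ) :
    ∫ x in Set.Ioo (-t) t, Complex.exp ((c * x : ℝ) * Complex.I)
      = ((2 * t * Real.sinc (c * t) : ℝ) : ℂ) := by
  rw [← integral_Ioc_eq_integral_Ioo, ← intervalIntegral.integral_of_le (by linarith)]
  rcases eq_or_ne c 0 with rfl | hc
  · simp
    ring
  · rw [intervalIntegral.integral_comp_mul_left (fun x : ℝ => Complex.exp (x * Complex.I)) hc,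
      mul_neg, integral_exp_mul_I_eq_sinc]
    have : (c : ℂ) ≠ 0 := by exact_mod_cast hc
    rw [Complex.real_smul]
    push_cast
    field_simp

/-- The integral over the strip factorizes: the real part of `z` yields the sinc, the imaginary part
a Gaussian integral. -/
theorem integral_coherentState_mul_conj {σ t : ℝ} (hσ : 0 < σ) (ht : 0 < t) (a b : ℝ) :
    ∫ z in strip t, coherentState σ t z a * conj (coherentState σ t z b)
      = dampedSineKernel σ t a b := by
  set u := Real.pi * a / t with hu
  set w := Real.pi * b / t with hw
  set A := √(1 / (2 * t * σ * √Real.pi)) with hA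
  have hA2 : A * A = 1 / (2 * t * σ * √Real.pi) := Real.mul_self_sqrt (by positivity)
  have h : ∀ z : ℂ, coherentState σ t z a * conj (coherentState σ t z b)
      = ((A * A * Real.exp (-(σ ^ 2 * (u ^ 2 + w ^ 2) / 2)) : ℝ) : ℂ) *
        ((fun x : ℝ => Complex.exp (((w - u) * x : ℝ) * Complex.I)) (Complex.measurableEquivRealProd z).1
        * (fun y : ℝ => ((Real.exp (-y ^ 2 / σ ^ 2 - (u + w) * y) : ℝ) : ℂ))
          (Complex.measurableEquivRealProd z).2) := fun z => by
    simp only [coherentState, ← hA, ← hu, ← hw, map_mul, Complex.conj_ofReal, ← Complex.exp_conj,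
      Complex.measurableEquivRealProd_apply, map_neg, Complex.conj_I, Complex.conj_conj]
    push_cast
    have e1 : ∀ a b c d : ℂ, (A : ℂ) * Complex.exp a * Complex.exp b * (A * Complex.exp c * Complex.exp d)
        = A * A * Complex.exp (a + b + c + d) := fun a b c d => by
      simp only [Complex.exp_add]; ring
    have e2 : ∀ a b c : ℂ, (A : ℂ) * A * Complex.exp a * (Complex.exp b * Complex.exp c)
        = A * A * Complex.exp (a + b + c) := fun a b c => by
      simp only [Complex.exp_add]; ring
    rw [e1, e2]
    congr 2
    have hz : z = z.re + z.im * Complex.I := (Complex.re_add_im z).symm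
    have hz' : conj z = z.re - z.im * Complex.I := by
      apply Complex.ext <;> simp
    rw [hz']
    linear_combination (u + w) * z.im * Complex.I_sq + w * Complex.I * hz
  simp_rw [h]
  rw [integral_const_mul, (measurePreserving_strip t).integral_comp'
    (g := fun p : ℝ × ℝ => (fun x : ℝ => Complex.exp (((w - u) * x : ℝ) * Complex.I)) p.1
      * (fun y : ℝ => ((Real.exp (-y ^ 2 / σ ^ 2 - (u + w) * y) : ℝ) : ℂ)) p.2), integral_prod_mul
      (fun x : ℝ => Complex.exp (((w - u) * x : ℝ) * Complex.I))
      (fun y : ℝ => ((Real.exp (-y ^ 2 / σ ^ 2 - (u + w) * y) : ℝ) : ℂ)),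
    integral_exp_mul_I_Ioo ht, integral_complex_ofReal, integral_exp_quadratic hσ,
    ← Complex.ofReal_mul, ← Complex.ofReal_mul, dampedSineKernel, hA2]
  have e1 : (w - u) * t = -(Real.pi * (a - b)) := by rw [hu, hw]; field_simp; ring
  -- $-(u^2+w^2)/2+(u+w)^2/4=-(u-w)^2/4$, and $u-w=\pi(a-b)/t$.
  have e2 : Real.exp (-(Real.pi * σ / (2 * t) * (a - b)) ^ 2)
      = Real.exp (-(σ ^ 2 * (u ^ 2 + w ^ 2) / 2)) * Real.exp (σ ^ 2 * (u + w) ^ 2 / 4) := by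
    rw [← Real.exp_add]
    congr 1
    rw [hu, hw]
    field_simp
    ring
  rw [e1, Real.sinc_neg, e2]
  congr 1
  have : √Real.pi ≠ 0 := by positivity
  field_simp

/-- The sine part is odd in `u` and the weight is even. -/
theorem intervalIntegral_exp_mul_cos (c : ℝ) (r : ℝ) (ζ : ℂ) :
    ∫ u in (-r)..r, (Real.exp (-(c * u) ^ 2) : ℂ) * Complex.cos (u * ζ)
      = ∫ u in (-r)..r, (Real.exp (-(c * u) ^ 2) : ℂ) * Complex.exp (u * ζ * Complex.I) := by
  set f : ℝ → ℂ := fun u => (Real.exp (-(c * u) ^ 2) : ℂ) * Complex.exp (u * ζ * Complex.I) with hf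
  have hfc : Continuous f := by fun_prop
  have hneg : ∫ u in (-r)..r, f (-u) = ∫ u in (-r)..r, f u := by
    rw [intervalIntegral.integral_comp_neg, neg_neg]
  have h : ∀ u : ℝ, (Real.exp (-(c * u) ^ 2) : ℂ) * Complex.cos (u * ζ)
      = (1 / 2 : ℂ) * (f u + f (-u)) := fun u => by
    have e : -(c * -u) ^ 2 = -(c * u) ^ 2 := by ring
    simp only [hf, Complex.cos, e, Complex.ofReal_neg, neg_mul]
    ring
  simp_rw [h]
  rw [intervalIntegral.integral_const_mul, intervalIntegral.integral_add
    (g := fun u => f (-u)) (hfc.intervalIntegrable _ _) ((hfc.comp continuous_neg).intervalIntegrable _ _), hneg]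
  ring

theorem integral_conj_coherentState_mul {σ t : ℝ} (hσ : 0 < σ) (ht : 0 < t) (z w : ℂ) :
    ∫ a in Set.Ioo (-t) t, conj (coherentState σ t z a) * coherentState σ t w a
      = sinKernel σ z w := by
  set A := √(1 / (2 * t * σ * √Real.pi)) with hA
  have hA2 : A * A = 1 / (2 * t * σ * √Real.pi) := Real.mul_self_sqrt (by positivity)
  set f : ℝ → ℂ := fun u =>
    (Real.exp (-(σ * u) ^ 2) : ℂ) * Complex.exp (u * (z - conj w) * Complex.I) with hf
  have h : ∀ a : ℝ, conj (coherentState σ t z a) * coherentState σ t w a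
      = ((A * A * Real.exp (-(z.im ^ 2 + w.im ^ 2) / (2 * σ ^ 2)) : ℝ) : ℂ)
        * f (Real.pi / t * a) := fun a => by
    have hu : Real.pi / t * a = Real.pi * a / t := by ring
    rw [hu]
    set u := Real.pi * a / t with hu
    simp only [coherentState, ← hA, ← hu, map_mul, Complex.conj_ofReal, ← Complex.exp_conj,
      map_neg, Complex.conj_I, Complex.conj_conj, hf]
    push_cast
    have e1 : ∀ a b c d : ℂ, (A : ℂ) * Complex.exp a * Complex.exp b * (A * Complex.exp c * Complex.exp d)
        = A * A * Complex.exp (a + b + c + d) := fun a b c d => by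
      simp only [Complex.exp_add]; ring
    have e2 : ∀ a b c : ℂ, (A : ℂ) * A * Complex.exp a * (Complex.exp b * Complex.exp c)
        = A * A * Complex.exp (a + b + c) := fun a b c => by
      simp only [Complex.exp_add]; ring
    rw [e1, e2]
    congr 2
    ring
  simp_rw [h]
  have hπ : Real.pi / t ≠ 0 := by positivity
  -- The substitution $u=\pi a/t$ carries $(-t,t)$ to $(-\pi,\pi)$; its Jacobian $t/\pi$ turns
  -- $1/(2t)$ into $1/(2\pi)$.
  rw [integral_const_mul, ← integral_Ioc_eq_integral_Ioo,
    ← intervalIntegral.integral_of_le (by linarith), intervalIntegral.integral_comp_mul_left f hπ,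
    mul_neg, div_mul_cancel₀ _ ht.ne', sinKernel, intervalIntegral_exp_mul_cos, Complex.real_smul,
    ← mul_assoc, ← mul_assoc, hA2]
  congr 1
  have h2 : (1 / (2 * (Real.pi : ℂ))) = ((1 / (2 * Real.pi) : ℝ) : ℂ) := by push_cast; rfl
  rw [h2, ← Complex.ofReal_mul, ← Complex.ofReal_mul]
  congr 1
  have : √Real.pi ≠ 0 := by positivity
  field_simp

theorem dampedSineOperator_coeFn (σ t : ℝ) (y : Lp ℂ 2 (volume.restrict (Set.Ioo (-t) t))) :
    dampedSineOperator σ t y =ᵐ[volume.restrict (Set.Ioo (-t) t)]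
      fun a => ∫ b in Set.Ioo (-t) t, dampedSineKernel σ t a b * y b :=
  (memLp_kernelIntegral (memLp_dampedSineKernel σ t) y).coeFn_toLp

/-- The family of coherent states, as vectors of `L²(-t, t)`. -/
noncomputable def coherentVector {σ t : ℝ} (hσ : 0 < σ) (ht : 0 < t) (z : ℂ) :
    Lp ℂ 2 (volume.restrict (Set.Ioo (-t) t)) :=
  (memLp_coherentState σ t hσ ht z).toLp

variable {σ t : ℝ} (hσ : 0 < σ) (ht : 0 < t)

theorem inner_coherentVector_left (z : ℂ) (y : Lp ℂ 2 (volume.restrict (Set.Ioo (-t) t))) :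
    ⟪coherentVector hσ ht z, y⟫_ℂ
      = ∫ a in Set.Ioo (-t) t, conj (coherentState σ t z a) * y a := by
  rw [L2.inner_def]
  refine integral_congr_ae ?_
  filter_upwards [(memLp_coherentState σ t hσ ht z).coeFn_toLp] with a ha
  rw [coherentVector, ha, RCLike.inner_apply, mul_comm]

theorem inner_coherentVector_right (z : ℂ) (x : Lp ℂ 2 (volume.restrict (Set.Ioo (-t) t))) :
    ⟪x, coherentVector hσ ht z⟫_ℂ
      = ∫ a in Set.Ioo (-t) t, conj (x a) * coherentState σ t z a := by
  rw [L2.inner_def]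
  refine integral_congr_ae ?_
  filter_upwards [(memLp_coherentState σ t hσ ht z).coeFn_toLp] with a ha
  rw [coherentVector, ha, RCLike.inner_apply, mul_comm]

theorem inner_coherentVector (z w : ℂ) :
    ⟪coherentVector hσ ht z, coherentVector hσ ht w⟫_ℂ = sinKernel σ z w := by
  rw [inner_coherentVector_left, ← integral_conj_coherentState_mul hσ ht]
  refine integral_congr_ae ?_
  filter_upwards [(memLp_coherentState σ t hσ ht w).coeFn_toLp] with a ha
  rw [coherentVector, ha]

theorem norm_coherentVector_sq (z : ℂ) : ‖coherentVector hσ ht z‖ ^ 2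
    = ∫ a in Set.Ioo (-t) t, ‖coherentState σ t z a‖ ^ 2 := by
  have h : ((‖coherentVector hσ ht z‖ ^ 2 : ℝ) : ℂ)
      = ((∫ a in Set.Ioo (-t) t, ‖coherentState σ t z a‖ ^ 2 : ℝ) : ℂ) := by
    rw [← integral_complex_ofReal]
    have := inner_coherentVector hσ ht z z
    rw [inner_self_eq_norm_sq_to_K, ← integral_conj_coherentState_mul hσ ht] at this
    simp only [Complex.conj_mul'] at this
    simpa using this
  exact_mod_cast h

theorem isRankOneIntegral_dampedSineOperator :
    IsRankOneIntegral (volume.restrict (strip t)) (coherentVector hσ ht)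
      (dampedSineOperator σ t) := by
  set ν : Measure ℝ := volume.restrict (Set.Ioo (-t) t) with hν
  set μ : Measure ℂ := volume.restrict (strip t) with hμ
  set C := √(1 / (2 * t * σ * √Real.pi)) * Real.exp ((σ * Real.pi) ^ 2 / 2) with hC
  set g : ℂ → ℝ := fun z => C * Real.exp (-(1 / (4 * σ ^ 2)) * z.im ^ 2) with hg
  have hφ : ∀ a ∈ Set.Ioo (-t) t, ∀ z, ‖coherentState σ t z a‖ ≤ g z := fun a ha z =>
    norm_coherentState_le hσ ht ha z
  clear_value C
  have hg2 : Integrable (fun z => g z ^ 2) μ := by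
    have h := (integrable_exp_strip t (c := 1 / (2 * σ ^ 2)) (by positivity)).const_mul (C ^ 2)
    refine h.congr (.of_forall fun z => ?_)
    simp only [hg]
    rw [mul_pow, ← Real.exp_nat_mul]
    congr 2
    push_cast
    field_simp
    ring
  have hmem : ∀ᵐ a ∂ν, a ∈ Set.Ioo (-t) t := ae_restrict_mem measurableSet_Ioo
  have hcont : Continuous fun p : ℂ × ℝ => coherentState σ t p.1 p.2 :=
    continuous_fst.coherentState continuous_snd σ t
  refine ⟨fun y => ?_, ?_, fun x y => ?_⟩
  · simp_rw [inner_coherentVector_left]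
    have : AEStronglyMeasurable (fun p : ℂ × ℝ => conj (coherentState σ t p.1 p.2) * y p.2)
        (μ.prod ν) :=
      (Complex.continuous_conj.comp hcont).aestronglyMeasurable.mul
        (Lp.aestronglyMeasurable y).comp_snd
    exact this.integral_prod_right'
  · simp_rw [norm_coherentVector_sq]
    have hm : AEStronglyMeasurable (fun p : ℂ × ℝ => ‖coherentState σ t p.1 p.2‖ ^ 2) (μ.prod ν) :=
      (hcont.norm.pow 2).aestronglyMeasurable
    refine (hg2.mul_const (ν.real Set.univ)).mono' hm.integral_prod_right' (.of_forall fun z => ?_)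
    refine norm_integral_le_of_norm_le_const ?_
    filter_upwards [hmem] with a ha
    rw [Real.norm_of_nonneg (by positivity)]
    exact pow_le_pow_left₀ (norm_nonneg _) (hφ a ha z) 2
  · have hx : Integrable x ν := (Lp.memLp x).integrable (by norm_num)
    have hy : Integrable y ν := (Lp.memLp y).integrable (by norm_num)
    let F : ℂ → ℝ × ℝ → ℂ := fun z p => (conj (x p.1) * coherentState σ t z p.1)
      * (conj (coherentState σ t z p.2) * y p.2)
    -- Fubini in $(z,a,b)$ with majorant $g(z)^2|x(a)||y(b)|$; `x` and `y` are integrable because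
    -- the interval has finite measure.
    have hF : Integrable (Function.uncurry F) (μ.prod (ν.prod ν)) := by
      refine (hg2.mul_prod (hx.norm.mul_prod hy.norm)).mono' ?_ ?_
      · have h1 : Continuous fun q : ℂ × ℝ × ℝ => coherentState σ t q.1 q.2.1 :=
          continuous_fst.coherentState (by fun_prop) σ t
        have h2 : Continuous fun q : ℂ × ℝ × ℝ => conj (coherentState σ t q.1 q.2.2) :=
          Complex.continuous_conj.comp (continuous_fst.coherentState (by fun_prop) σ t)
        exact ((Complex.continuous_conj.comp_aestronglyMeasurable
          hx.1.comp_fst.comp_snd).mul h1.aestronglyMeasurable).mul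
          (h2.aestronglyMeasurable.mul hy.1.comp_snd.comp_snd)
      · have h1 : ∀ᵐ q ∂(μ.prod (ν.prod ν)), q.2.1 ∈ Set.Ioo (-t) t :=
          Measure.quasiMeasurePreserving_snd.ae (Measure.quasiMeasurePreserving_fst.ae hmem)
        have h2 : ∀ᵐ q ∂(μ.prod (ν.prod ν)), q.2.2 ∈ Set.Ioo (-t) t :=
          Measure.quasiMeasurePreserving_snd.ae (Measure.quasiMeasurePreserving_snd.ae hmem)
        filter_upwards [h1, h2] with q hq1 hq2
        simp only [F, Function.uncurry, norm_mul, RCLike.norm_conj]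
        have i1 := hφ _ hq1 q.1
        have i2 := hφ _ hq2 q.1
        have i3 : 0 ≤ g q.1 := (norm_nonneg _).trans i1
        calc _ ≤ (‖x q.2.1‖ * g q.1) * (g q.1 * ‖y q.2.2‖) := by gcongr
          _ = _ := by ring
    have hS : ∀ p : ℝ × ℝ, ∫ z, F z p ∂μ
        = conj (x p.1) * (dampedSineKernel σ t p.1 p.2 * y p.2) := fun p => by
      rw [← integral_coherentState_mul_conj hσ ht, ← integral_mul_const, ← integral_const_mul]
      refine integral_congr_ae (.of_forall fun z => ?_)
      simp only [F]
      ring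
    have hSint : Integrable (fun p : ℝ × ℝ =>
        conj (x p.1) * (dampedSineKernel σ t p.1 p.2 * y p.2)) (ν.prod ν) := by
      simpa only [← hS] using! hF.integral_prod_right
    calc ⟪x, dampedSineOperator σ t y⟫_ℂ
        = ∫ a, conj (x a) * ∫ b, dampedSineKernel σ t a b * y b ∂ν ∂ν := by
          rw [L2.inner_def]
          refine integral_congr_ae ?_
          filter_upwards [dampedSineOperator_coeFn σ t y] with a ha
          rw [RCLike.inner_apply, mul_comm, ha]
      _ = ∫ p, conj (x p.1) * (dampedSineKernel σ t p.1 p.2 * y p.2) ∂(ν.prod ν) := by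
          rw [integral_prod _ hSint]
          simp_rw [integral_const_mul]
      _ = ∫ p, ∫ z, F z p ∂μ ∂(ν.prod ν) := by simp_rw [hS]
      _ = ∫ z, ∫ p, F z p ∂(ν.prod ν) ∂μ := (integral_integral_swap hF).symm
      _ = _ := by
          refine integral_congr_ae (.of_forall fun z => ?_)
          change _ = ⟪x, coherentVector hσ ht z⟫_ℂ * ⟪coherentVector hσ ht z, y⟫_ℂ
          rw [inner_coherentVector_left, inner_coherentVector_right, ← integral_prod_mul]

end CoherentStates

/-! ### The determinant identity for the strip. -/

theorem mainTheorem9 (σ t : ℝ) (hσ : 0 < σ) (ht : 0 < t) :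
    -- the Fredholm series defining `G_σ(t)` is well defined and converges absolutely
    (∀ ℓ : ℕ, IntegrableOn (sinKernelDet σ ℓ) (Set.univ.pi fun _ : Fin ℓ => strip t)) ∧
    Summable (fun ℓ : ℕ => fredholmTerm σ t (ℓ + 1)) ∧
    -- the non-zero eigenvalues of `S_t^σ` have finite multiplicity and are absolutely summable
    (∀ z : ℂ, z ≠ 0 → FiniteDimensional ℂ
      (Module.End.maxGenEigenspace
        (dampedSineOperator σ t :
          Module.End ℂ (Lp ℂ 2 (volume.restrict (Set.Ioo (-t) t)))) z)) ∧
    Summable (fun i => ‖nonzeroEigenvalue (dampedSineOperator σ t) i‖) ∧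
    -- the Fredholm determinant equals the product over these eigenvalues
    HasProd (fun i => 1 - nonzeroEigenvalue (dampedSineOperator σ t) i) (fredholmG σ t) := by
  have h := isRankOneIntegral_dampedSineOperator hσ ht
  have : Fact ((2 : ENNReal) ≠ ⊤) := ⟨by simp⟩
  have hdet : ∀ ℓ : ℕ, (fun z : Fin ℓ → ℂ => (Matrix.of fun j k =>
      inner ℂ (coherentVector hσ ht (z j)) (coherentVector hσ ht (z k))).det)
      = sinKernelDet σ ℓ := fun ℓ => by
    ext z
    simp_rw [inner_coherentVector, sinKernelDet]
  have hpi : ∀ ℓ : ℕ, Measure.pi (fun _ : Fin ℓ => (volume.restrict (strip t) : Measure ℂ))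
      = volume.restrict (Set.univ.pi fun _ : Fin ℓ => strip t) := fun ℓ => by
    rw [volume_pi, Measure.restrict_pi_pi]
  have hterm : ∀ ℓ : ℕ, (-1) ^ ℓ / (ℓ.factorial : ℂ) * ∫ z : Fin ℓ → ℂ, (Matrix.of fun j k =>
      inner ℂ (coherentVector hσ ht (z j)) (coherentVector hσ ht (z k))).det
        ∂(Measure.pi fun _ => volume.restrict (strip t)) = fredholmTerm σ t ℓ := fun ℓ => by
    rw [hdet, hpi, fredholmTerm]
  obtain ⟨hsum, hprod⟩ := h.summable_and_hasProd
  simp_rw [hterm] at hsum hprod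
  refine ⟨fun ℓ => ?_, (summable_nat_add_iff 1).mpr hsum,
    fun z hz => h.isCompactOperator.finiteDimensional_maxGenEigenspace h.isSymmetric hz,
    h.summable_norm_nonzeroEigenvalue, ?_⟩
  · have := h.integrable_det ℓ
    rwa [hdet, hpi] at this
  · rw [hsum.tsum_eq_zero_add] at hprod
    -- The empty determinant is one and the space of empty tuples has mass one; this is the separate
    -- $1$ in `fredholmG`.
    have h0 : fredholmTerm σ t 0 = 1 := by
      rw [← hterm]
      simp [measureReal_def]
    rwa [h0] at hprod
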